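/- Let $K$ be a field, let $n\ge 4$, and let $S=K[x_1,\dots,x_n]$ be the polynomial ring with its standard grading. Let $G$ be a simple graph with vertex set $\{1,\dots,n\}$ and edge set $E(G)$, and let $$I_c(G)=\Bigl(\tfrac{x_1\cdots x_n}{x_ix_j} : \{i,j\}\in E(G)\Bigr)\subseteq S$$ be its complementary edge ideal. Then $I_c(G)$ has a minimal graded free resolution with terms of finite rank, and the graded Betti numbers $\beta_{i,j}(I_c(G))$ (the number of copies of $S(-j)$ in the $i$-th term of a minimal graded free resolution of $I_c(G)$, where the terms are numbered from $i=0$) satisfy $$\beta_{i,j}(I_c(G))\neq 0\ \Longrightarrow\ (i,j)\in\{(0,n-2),\,(1,n-1),\,(1,n),\,(2,n)\}.$$ If moreover $G$ has no isolated vertices, then the projective dimension and the Castelnuovo–Mumford regularity $\operatorname{reg}(I_c(G))=\max\{j-i : \beta_{i,j}(I_c(G))\neq 0\}$ satisfy $$1\le \operatorname{pd}(I_c(G))\le 2,\qquad n-2\le \operatorname{reg}(I_c(G))\le n-1 .$$ -/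

import Mathlib

open MvPolynomial

/-- The complementary edge ideal of a graph `G` on `n` vertices: the ideal of `K[x_1, …, x_n]`
generated by the products of all variables except `x_i` and `x_j`, for the edges `{i, j}`. -/
noncomputable def complementaryEdgeIdeal (K : Type*) [Field K] {n : ℕ}
    (G : SimpleGraph (Fin n)) : Ideal (MvPolynomial (Fin n) K) :=
  Ideal.span {u | ∃ i j : Fin n, G.Adj i j ∧ u = ∏ k ∈ ({i, j} : Finset (Fin n))ᶜ, X k}

/-- A minimal graded free resolution `⋯ → F_2 → F_1 → F_0 → I → 0` of an ideal `I` of the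
standard graded polynomial ring `S = K[x_1, …, x_n]`. The module `F_i` is free on a finite
homogeneous basis `e_1, …, e_r`, where `r = rank i` and `e_a` has degree `deg i a`; that is,
`F_i = ⨁ₐ S(-deg i a)`. -/
structure MinimalGradedFreeResolution {K : Type*} [Field K] {n : ℕ}
    (I : Ideal (MvPolynomial (Fin n) K)) where
  /-- the rank of `F_i` -/
  rank : ℕ → ℕ
  /-- the degrees of the basis elements of `F_i` -/
  deg : (i : ℕ) → Fin (rank i) → ℕ
  /-- the augmentation `F_0 → S`, with image `I` -/
  aug : (Fin (rank 0) → MvPolynomial (Fin n) K) →ₗ[MvPolynomial (Fin n) K]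
    MvPolynomial (Fin n) K
  /-- the differential `F_{i+1} → F_i` -/
  d : (i : ℕ) → (Fin (rank (i + 1)) → MvPolynomial (Fin n) K) →ₗ[MvPolynomial (Fin n) K]
    (Fin (rank i) → MvPolynomial (Fin n) K)
  /-- the augmentation is homogeneous of degree `0` -/
  aug_homogeneous : ∀ b, (aug (Pi.single b 1)).IsHomogeneous (deg 0 b)
  /-- the differentials are homogeneous of degree `0`: a nonzero matrix entry in row `a` and
  column `b` is homogeneous of degree `deg i a` less than `deg (i + 1) b` -/
  d_homogeneous : ∀ i a b, d i (Pi.single b 1) a ≠ 0 →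
    ∃ k, deg i a + k = deg (i + 1) b ∧ (d i (Pi.single b 1) a).IsHomogeneous k
  /-- the image of the augmentation is `I` -/
  range_aug : LinearMap.range aug = I
  /-- exactness at `F_0` -/
  exact_zero : Function.Exact (d 0) aug
  /-- exactness at `F_{i+1}` -/
  exact_succ : ∀ i, Function.Exact (d (i + 1)) (d i)
  /-- minimality: the image of `F_{i+1}` lies in `(x_1, …, x_n) F_i`, i.e. the entries of the
  matrices of the differentials have zero constant term -/
  minimal : ∀ i a b, constantCoeff (d i (Pi.single b 1) a) = 0

namespace MinimalGradedFreeResolution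

variable {K : Type*} [Field K] {n : ℕ} {I : Ideal (MvPolynomial (Fin n) K)}

/-- The graded Betti number `β_{i,j}(I)`, read off a minimal graded free resolution of `I`: the
number of copies of `S(-j)` in `F_i`. -/
def betti (F : MinimalGradedFreeResolution I) (i j : ℕ) : ℕ :=
  Fintype.card {a : Fin (F.rank i) // F.deg i a = j}

/-- `r` is the Castelnuovo–Mumford regularity of `I`: `r = max {j - i : β_{i,j}(I) ≠ 0}`. -/
def IsRegularity (F : MinimalGradedFreeResolution I) (r : ℤ) : Prop :=
  IsGreatest {s : ℤ | ∃ i j : ℕ, F.betti i j ≠ 0 ∧ s = (j : ℤ) - (i : ℤ)} r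

end MinimalGradedFreeResolution

/-! Write `P` for the product of all variables and `m_e = P / (x_i x_j)` for an edge `e = {i, j}`.
The core is an explicit graded free resolution of length two, valid for every graph.

Let `∑ f_e m_e = 0`. Modulo `(x_i, x_j)` all other generators vanish and `m_e` is a nonzerodivisor,
so `f_e = x_j a + x_i b`; thus `f` comes from a function on darts (edges with a chosen end). As `x_j
m_e = P / x_i`, the relation becomes `∑_v (P / x_v) s_v = 0`, where `s_v` sums over the darts at
`v`. Hence `s_v = x_v t_v` with `∑ t_v = 0`, and moving terms `x_i x_j c_e` with `∑ c_e = 0` to the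
edges makes every `s_v` vanish. So the syzygies come from dart functions with zero sum at each
vertex (degree `n - 1`) and edge functions with zero sum (degree `n`). Both modules are free, and
the relations between them form a free module generated in degree `n` (`edgeAug_exact`,
`edgeD₁_exact`, `edgeD₂_injective`).

This resolution need not be minimal, but the degrees in a minimal one occur, in the same homological
position, in every graded free resolution (`AreComparable.exists_degree_eq`). That bounds the Betti
numbers, hence the regularity; the length gives `pd ≤ 2`. Without isolated vertices the ideal is not
projective, so `pd ≥ 1`. A minimal resolution exists by iterating minimal homogeneous covers. -/

/-! ### Graded free modules and minimal homogeneous generators. -/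

section GradedFree

variable {σ K : Type*} [Field K] {ι κ : Type*}

/-- `f` is homogeneous of degree `t` in `⨁ₐ S(-δ a)`. -/
def IsHomogVec (δ : ι → ℕ) (t : ℕ) (f : ι → MvPolynomial σ K) : Prop :=
  ∀ a, f a ≠ 0 → ∃ k, δ a + k = t ∧ (f a).IsHomogeneous k

/-- The component of degree `t` of an element of `⨁ₐ S(-δ a)`. -/
noncomputable def degComp (δ : ι → ℕ) (t : ℕ) (f : ι → MvPolynomial σ K) :
    ι → MvPolynomial σ K :=
  fun a => if δ a ≤ t then homogeneousComponent (t - δ a) (f a) else 0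

theorem isHomogVec_degComp (δ : ι → ℕ) (t : ℕ) (f : ι → MvPolynomial σ K) :
    IsHomogVec δ t (degComp δ t f) := by
  intro a ha
  unfold degComp at ha ⊢
  split_ifs at ha ⊢ with h
  · exact ⟨t - δ a, by omega, homogeneousComponent_isHomogeneous _ _⟩
  · exact absurd rfl ha

theorem IsHomogVec.degComp_eq {δ : ι → ℕ} {t : ℕ} {f : ι → MvPolynomial σ K}
    (hf : IsHomogVec δ t f) : degComp δ t f = f := by
  funext a
  unfold degComp
  by_cases h0 : f a = 0
  · simp [h0]
  · obtain ⟨k, hk, hh⟩ := hf a h0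
    have : t - δ a = k := by omega
    rw [if_pos (by omega), this, homogeneousComponent_eq_self hh]

theorem degComp_add (δ : ι → ℕ) (t : ℕ) (f g : ι → MvPolynomial σ K) :
    degComp δ t (f + g) = degComp δ t f + degComp δ t g := by
  funext a
  simp only [degComp, Pi.add_apply]
  split_ifs <;> simp

theorem degComp_zero (δ : ι → ℕ) (t : ℕ) :
    degComp δ t (0 : ι → MvPolynomial σ K) = 0 := by
  funext a
  simp [degComp]

theorem degComp_sum {τ : Type*} (s : Finset τ) (δ : ι → ℕ) (t : ℕ)
    (f : τ → ι → MvPolynomial σ K) :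
    degComp δ t (∑ b ∈ s, f b) = ∑ b ∈ s, degComp δ t (f b) :=
  map_sum (AddMonoidHom.mk' (degComp (σ := σ) (K := K) δ t) (degComp_add δ t)) f s

theorem exists_sum_degComp [Finite ι] (δ : ι → ℕ) (f : ι → MvPolynomial σ K) :
    ∃ T, f = ∑ t ∈ Finset.range T, degComp δ t f := by
  obtain ⟨T, hT⟩ := (Set.finite_range fun a => δ a + (f a).totalDegree).bddAbove
  refine ⟨T + 1, funext fun a => ?_⟩
  have ha : δ a + (f a).totalDegree ≤ T := hT ⟨a, rfl⟩
  rw [Finset.sum_apply]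
  have h1 : ∀ t, degComp δ t f a =
      if δ a ≤ t then homogeneousComponent (t - δ a) (f a) else 0 := fun t => rfl
  simp_rw [h1]
  rw [← Finset.sum_filter]
  have h2 : ∑ t ∈ Finset.range (T + 1) with δ a ≤ t, homogeneousComponent (t - δ a) (f a) =
      ∑ i ∈ Finset.range (T + 1 - δ a), homogeneousComponent i (f a) := by
    refine Finset.sum_bij' (fun t _ => t - δ a) (fun i _ => i + δ a) ?_ ?_ ?_ ?_ ?_ <;>
      simp <;> omega
  rw [h2, ← Finset.sum_subset (Finset.range_mono
    (show (f a).totalDegree + 1 ≤ T + 1 - δ a by omega)), sum_homogeneousComponent]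
  intro i _ hi
  exact homogeneousComponent_eq_zero _ _ (by simp at hi; omega)

attribute [local instance] MvPolynomial.gradedAlgebra in
theorem homogeneousComponent_mul_of_isHomogeneous {p q : MvPolynomial σ K} {k : ℕ}
    (hq : q.IsHomogeneous k) (m : ℕ) :
    homogeneousComponent m (p * q) =
      if k ≤ m then homogeneousComponent (m - k) p * q else 0 := by
  have h : ∀ (f : MvPolynomial σ K) i,
      (DirectSum.decompose (homogeneousSubmodule σ K) f i : MvPolynomial σ K) =
        homogeneousComponent i f := decomposition.decompose'_apply
  rw [← h, ← h]
  exact DirectSum.coe_decompose_mul_of_right_mem _ m hq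

theorem IsHomogVec.degComp_smul {δ : ι → ℕ} {s : ℕ} {f : ι → MvPolynomial σ K}
    (hf : IsHomogVec δ s f) (p : MvPolynomial σ K) (t : ℕ) :
    degComp δ t (p • f) = (if s ≤ t then homogeneousComponent (t - s) p else 0) • f := by
  funext a
  simp only [degComp, Pi.smul_apply, smul_eq_mul]
  by_cases h0 : f a = 0
  · simp [h0]
  obtain ⟨k, hk, hh⟩ := hf a h0
  rw [homogeneousComponent_mul_of_isHomogeneous hh]
  by_cases hst : s ≤ t
  · rw [if_pos (by omega), if_pos (by omega), if_pos hst]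
    congr 3
    omega
  · rw [if_neg hst, zero_mul]
    split_ifs
    · omega
    · rfl
    · rfl

/-- A homogeneous linear map of degree `0` between graded free modules. -/
def IsGradedMap [DecidableEq ι] (δ : ι → ℕ) (ε : κ → ℕ)
    (g : (ι → MvPolynomial σ K) →ₗ[MvPolynomial σ K] (κ → MvPolynomial σ K)) : Prop :=
  ∀ b, IsHomogVec ε (δ b) (g (Pi.single b 1))

theorem map_eq_sum_single {R M : Type*} [CommSemiring R] [AddCommMonoid M] [Module R M]
    [Fintype ι] [DecidableEq ι] (g : (ι → R) →ₗ[R] M) (f : ι → R) :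
    g f = ∑ b, f b • g (Pi.single b 1) := by
  conv_lhs => rw [← Finset.univ_sum_single f]
  rw [map_sum]
  refine Finset.sum_congr rfl fun b _ => ?_
  rw [← map_smul, ← Pi.single_smul', smul_eq_mul, mul_one]

theorem IsGradedMap.map_degComp [Fintype ι] [DecidableEq ι] {δ : ι → ℕ} {ε : κ → ℕ}
    {g : (ι → MvPolynomial σ K) →ₗ[MvPolynomial σ K] (κ → MvPolynomial σ K)}
    (hg : IsGradedMap δ ε g) (t : ℕ) (f : ι → MvPolynomial σ K) :
    g (degComp δ t f) = degComp ε t (g f) := by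
  rw [map_eq_sum_single g, map_eq_sum_single g f, degComp_sum]
  exact Finset.sum_congr rfl fun b _ => ((hg b).degComp_smul _ _).symm

/-- Graded Nakayama: in a homogeneous generating family of least cardinality, a relation with a unit
constant term would make one generator redundant. -/
theorem exists_minimal_homogeneous_generators {σ K : Type*} [Field K] [Finite σ] {ι : Type*}
    [Finite ι] (δ : ι → ℕ) (N : Submodule (MvPolynomial σ K) (ι → MvPolynomial σ K))
    (hN : ∀ t, ∀ f ∈ N, degComp δ t f ∈ N) :
    ∃ (r : ℕ) (deg : Fin r → ℕ) (g : Fin r → ι → MvPolynomial σ K),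
      (∀ a, IsHomogVec δ (deg a) (g a)) ∧ Submodule.span _ (Set.range g) = N ∧
      ∀ c : Fin r → MvPolynomial σ K, ∑ a, c a • g a = 0 → ∀ a, constantCoeff (c a) = 0 := by
  classical
  have hex : ∃ (r : ℕ) (deg : Fin r → ℕ) (g : Fin r → ι → MvPolynomial σ K),
      (∀ a, IsHomogVec δ (deg a) (g a)) ∧ Submodule.span _ (Set.range g) = N := by
    have hspan : Submodule.span (MvPolynomial σ K) {f | f ∈ N ∧ ∃ t, IsHomogVec δ t f} = N := by
      refine le_antisymm (Submodule.span_le.2 fun f hf => hf.1) fun f hf => ?_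
      obtain ⟨T, hT⟩ := exists_sum_degComp δ f
      rw [hT]
      exact Submodule.sum_mem _ fun t _ => Submodule.subset_span
        ⟨hN t f hf, t, isHomogVec_degComp δ t f⟩
    have hfg : N.FG := IsNoetherian.noetherian N
    rw [← hspan, Submodule.fg_span_iff_fg_span_finset_subset] at hfg
    obtain ⟨s, hs, hs'⟩ := hfg
    rw [hspan] at hs'
    have hd : ∀ x : s, ∃ t, IsHomogVec δ t x.1 := fun x => (hs x.2).2
    choose d hd using hd
    refine ⟨s.card, fun a => d (s.equivFin.symm a), fun a => (s.equivFin.symm a).1,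
      fun a => hd _, ?_⟩
    rw [hs']
    congr 1
    ext x
    constructor
    · rintro ⟨a, rfl⟩
      exact (s.equivFin.symm a).2
    · intro hx
      exact ⟨s.equivFin ⟨x, hx⟩, by simp⟩
  obtain ⟨deg, g, hg, hsp⟩ := Nat.find_spec hex
  refine ⟨_, deg, g, hg, hsp, fun c hc a => ?_⟩
  by_contra hne
  generalize hr : Nat.find hex = r at deg g a c
  obtain _ | r := r
  · exact a.elim0
  refine Nat.find_min hex (m := r) (by omega) ⟨fun b => deg (a.succAbove b),
    fun b => g (a.succAbove b), fun b => hg _, ?_⟩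
  rw [← hsp]
  refine le_antisymm (Submodule.span_mono (Set.range_comp_subset_range a.succAbove g))
    (Submodule.span_le.2 ?_)
  rintro _ ⟨b, rfl⟩
  rcases Fin.eq_self_or_eq_succAbove a b with rfl | ⟨b', rfl⟩
  swap
  · exact Submodule.subset_span ⟨b', rfl⟩
  -- In degree `deg b` the coefficient of `g b` shrinks to the constant term of `c b`, which is a
  -- unit, so `g b` lies in the span of the others.
  have h1 := congrArg (degComp δ (deg b)) hc
  rw [degComp_zero, degComp_sum, Fin.sum_univ_succAbove _ b, (hg b).degComp_smul] at h1
  simp only [le_refl, if_true, Nat.sub_self, homogeneousComponent_zero] at h1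
  rw [SetLike.mem_coe, ← Submodule.smul_mem_iff_of_isUnit _ (r := C (coeff 0 (c b)))
    ((IsUnit.mk0 _ hne).map C), eq_neg_of_add_eq_zero_left h1]
  refine Submodule.neg_mem _ (Submodule.sum_mem _ fun b' _ => ?_)
  rw [(hg _).degComp_smul]
  exact Submodule.smul_mem _ _ (Submodule.subset_span ⟨b', rfl⟩)

end GradedFree

/-! ### Existence of minimal graded free resolutions. -/

section Existence

variable {K : Type*} [Field K] {n : ℕ}

/-- A homogeneous submodule of a graded free module of finite rank. -/
structure GradedSubmodule (K : Type*) [Field K] (n : ℕ) where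
  /-- the rank of the free module -/
  rank : ℕ
  /-- the degrees of the basis elements -/
  deg : Fin rank → ℕ
  /-- the submodule -/
  carrier : Submodule (MvPolynomial (Fin n) K) (Fin rank → MvPolynomial (Fin n) K)
  degComp_mem : ∀ t, ∀ f ∈ carrier, degComp deg t f ∈ carrier

namespace GradedSubmodule

theorem exists_cover (N : GradedSubmodule K n) :
    ∃ (M : GradedSubmodule K n)
      (d : (Fin M.rank → MvPolynomial (Fin n) K) →ₗ[MvPolynomial (Fin n) K]
        (Fin N.rank → MvPolynomial (Fin n) K)),
      IsGradedMap M.deg N.deg d ∧ LinearMap.range d = N.carrier ∧ LinearMap.ker d = M.carrier ∧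
      ∀ f ∈ M.carrier, ∀ a, constantCoeff (f a) = 0 := by
  obtain ⟨r, deg, g, hg, hsp, hmin⟩ :=
    exists_minimal_homogeneous_generators N.deg N.carrier N.degComp_mem
  have hd : IsGradedMap deg N.deg (Fintype.linearCombination (MvPolynomial (Fin n) K) g) := by
    intro b
    rw [Fintype.linearCombination_apply_single, one_smul]
    exact hg b
  refine ⟨⟨r, deg, LinearMap.ker (Fintype.linearCombination _ g), fun t f hf => ?_⟩,
    Fintype.linearCombination _ g, hd, ?_, rfl, fun f hf => hmin f ?_⟩
  · rw [LinearMap.mem_ker] at hf ⊢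
    rw [hd.map_degComp, hf, degComp_zero]
  · rw [Fintype.range_linearCombination, hsp]
  · simpa [Fintype.linearCombination_apply] using hf

/-- The module of relations between the elements of a minimal homogeneous generating family. -/
noncomputable def syzygy (N : GradedSubmodule K n) : GradedSubmodule K n :=
  N.exists_cover.choose

/-- The map from a graded free module onto `N` given by a minimal homogeneous generating family. -/
noncomputable def cover (N : GradedSubmodule K n) :
    (Fin N.syzygy.rank → MvPolynomial (Fin n) K) →ₗ[MvPolynomial (Fin n) K]
      (Fin N.rank → MvPolynomial (Fin n) K) :=
  N.exists_cover.choose_spec.choose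

theorem cover_spec (N : GradedSubmodule K n) :
    IsGradedMap N.syzygy.deg N.deg N.cover ∧ LinearMap.range N.cover = N.carrier ∧
      LinearMap.ker N.cover = N.syzygy.carrier ∧
      ∀ f ∈ N.syzygy.carrier, ∀ a, constantCoeff (f a) = 0 :=
  N.exists_cover.choose_spec.choose_spec

/-- The iterated syzygies of `N`. -/
noncomputable def iterSyzygy (N : GradedSubmodule K n) : ℕ → GradedSubmodule K n
  | 0 => N
  | i + 1 => (N.iterSyzygy i).syzygy

end GradedSubmodule

theorem nonempty_minimalGradedFreeResolution_of_syzygies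
    (I : Ideal (MvPolynomial (Fin n) K)) (M : ℕ → GradedSubmodule K n)
    (d : (i : ℕ) → (Fin (M (i + 1)).rank → MvPolynomial (Fin n) K) →ₗ[MvPolynomial (Fin n) K]
      (Fin (M i).rank → MvPolynomial (Fin n) K))
    (hd : ∀ i, IsGradedMap (M (i + 1)).deg (M i).deg (d i) ∧
      LinearMap.range (d i) = (M i).carrier ∧ LinearMap.ker (d i) = (M (i + 1)).carrier ∧
      ∀ f ∈ (M (i + 1)).carrier, ∀ a, constantCoeff (f a) = 0)
    (c : Fin (M 0).rank) (hc : ∀ a, a = c) (hdeg : (M 0).deg c = 0)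
    (hI : (M 0).carrier = Submodule.comap (LinearMap.proj c) I) :
    Nonempty (MinimalGradedFreeResolution I) := by
  have hπ : ∀ f : Fin (M 0).rank → MvPolynomial (Fin n) K,
      f c = 0 ↔ f = 0 := fun f =>
    ⟨fun h => funext fun a => by rw [hc a]; exact h, fun h => by rw [h]; rfl⟩
  have hker : ∀ i f, d i f = 0 ↔ f ∈ (M (i + 1)).carrier := by
    intro i f
    rw [← LinearMap.mem_ker, (hd i).2.2.1]
  have hrange : ∀ i f, f ∈ (M i).carrier ↔ f ∈ Set.range (d i) := by
    intro i f
    rw [← (hd i).2.1]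
    rfl
  refine ⟨{
    -- The index shifts by one: `M 0` is the ideal inside `S`, and `M (i + 1)` is a syzygy module
    -- inside `F_i`.
    rank := fun i => (M (i + 1)).rank
    deg := fun i => (M (i + 1)).deg
    aug := LinearMap.proj c ∘ₗ d 0
    d := fun i => d (i + 1)
    aug_homogeneous := fun b => ?_
    d_homogeneous := fun i a b => (hd (i + 1)).1 b a
    range_aug := ?_
    exact_zero := fun f => ?_
    exact_succ := fun i f => ?_
    minimal := fun i a b => (hd i).2.2.2 _ ((hrange (i + 1) _).2 ⟨_, rfl⟩) a }⟩
  · rw [LinearMap.comp_apply, LinearMap.proj_apply]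
    by_cases h0 : d 0 (Pi.single b 1) c = 0
    · rw [h0]
      exact isHomogeneous_zero _ _ _
    · obtain ⟨k, hk, hh⟩ := (hd 0).1 b c h0
      have : k = (M 1).deg b := by rw [← hk, hdeg, zero_add]
      rw [← this]
      exact hh
  · rw [LinearMap.range_comp, (hd 0).2.1, hI]
    exact Submodule.map_comap_eq_of_surjective 
      (LinearMap.proj_surjective (φ := fun _ => MvPolynomial (Fin n) K) c) I
  · rw [LinearMap.comp_apply, LinearMap.proj_apply, hπ, hker, hrange]
  · rw [hker, hrange]

attribute [local instance] MvPolynomial.gradedAlgebra in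
theorem nonempty_minimalGradedFreeResolution (I : Ideal (MvPolynomial (Fin n) K))
    (hI : I.IsHomogeneous (homogeneousSubmodule (Fin n) K)) :
    Nonempty (MinimalGradedFreeResolution I) := by
  let N : GradedSubmodule K n := ⟨1, fun _ => 0, Submodule.comap (LinearMap.proj 0) I,
    fun t f hf => by
      have : degComp (fun _ => 0) t f 0 = homogeneousComponent t (f 0) := by
        simp [degComp]
      rw [Submodule.mem_comap, LinearMap.proj_apply, this]
      exact homogeneousComponent_mem_of_mem hI hf t⟩
  exact nonempty_minimalGradedFreeResolution_of_syzygies I N.iterSyzygy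
    (fun i => (N.iterSyzygy i).cover) (fun i => (N.iterSyzygy i).cover_spec) (0 : Fin 1)
    (fun a => Subsingleton.elim (α := Fin 1) a 0) rfl rfl

attribute [local instance] MvPolynomial.gradedAlgebra in
theorem isHomogeneous_complementaryEdgeIdeal (G : SimpleGraph (Fin n)) :
    (complementaryEdgeIdeal K G).IsHomogeneous (homogeneousSubmodule (Fin n) K) := by
  refine Ideal.homogeneous_span _ _ ?_
  rintro _ ⟨i, j, -, rfl⟩
  exact ⟨_, IsHomogeneous.prod _ _ (fun _ => 1) fun k _ => isHomogeneous_X K k⟩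

end Existence

/-! ### Comparison of a minimal resolution with an arbitrary graded one. -/

section Comparison

variable {σ K : Type*} [Field K]

theorem constantCoeff_map_eq_zero {ι κ : Type*} [Fintype ι]
    (g : (ι → MvPolynomial σ K) →ₗ[MvPolynomial σ K] (κ → MvPolynomial σ K))
    {f : ι → MvPolynomial σ K} (hf : ∀ a, constantCoeff (f a) = 0) (b : κ) :
    constantCoeff (g f b) = 0 := by
  classical
  rw [map_eq_sum_single g, Finset.sum_apply, map_sum]
  exact Finset.sum_eq_zero fun a _ => by simp [hf a]

variable {ιA ιC ιF ιP ιF' ιP' : Type*} [Fintype ιA] [Fintype ιF] [Fintype ιP]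
  [DecidableEq ιA] [DecidableEq ιF] [DecidableEq ιP]
  {δA : ιA → ℕ} {δC : ιC → ℕ} {δF : ιF → ℕ} {δP : ιP → ℕ}

/-- There are maps between the targets of `f` and `p` that respect the images, such that the
composition on the image of `f` is the identity up to a map that factors through `f`, as the
components in one degree of a chain homotopy equivalence do. -/
def AreComparable (δA : ιA → ℕ) (δC : ιC → ℕ)
    (f : (ιF → MvPolynomial σ K) →ₗ[MvPolynomial σ K] (ιA → MvPolynomial σ K))
    (p : (ιP → MvPolynomial σ K) →ₗ[MvPolynomial σ K] (ιC → MvPolynomial σ K)) : Prop :=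
  ∃ (a : (ιA → MvPolynomial σ K) →ₗ[MvPolynomial σ K] (ιC → MvPolynomial σ K))
    (b : (ιC → MvPolynomial σ K) →ₗ[MvPolynomial σ K] (ιA → MvPolynomial σ K))
    (h : (ιA → MvPolynomial σ K) →ₗ[MvPolynomial σ K] (ιF → MvPolynomial σ K)),
    IsGradedMap δA δC a ∧ (∀ x, ∃ y, a (f x) = p y) ∧ (∀ y, ∃ x, b (p y) = f x) ∧
    (∀ x, b (a (f x)) + f (h (f x)) = f x) ∧ ∀ x i, constantCoeff (h (f x) i) = 0

theorem exists_lift {R M ι : Type*} [CommSemiring R] [AddCommMonoid M] [Module R M] [Fintype ι]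
    [DecidableEq ι] {N : Type*} [AddCommMonoid N] [Module R N] (g : (ι → R) →ₗ[R] M)
    (p : N →ₗ[R] M) (Q : ι → N → Prop) (h : ∀ i, ∃ y, g (Pi.single i 1) = p y ∧ Q i y) :
    ∃ l : (ι → R) →ₗ[R] N, (∀ x, p (l x) = g x) ∧ ∀ i, Q i (l (Pi.single i 1)) := by
  choose y hy hQ using h
  refine ⟨Fintype.linearCombination R y, fun x => ?_, fun i => ?_⟩
  · rw [map_eq_sum_single g, Fintype.linearCombination_apply, map_sum]
    exact Finset.sum_congr rfl fun i _ => by rw [map_smul, hy]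
  · rw [Fintype.linearCombination_apply_single, one_smul]
    exact hQ i

/-- `α` and `β` lift `a ∘ f` and `b ∘ p`. Taking homogeneous components makes `α` graded; `β` need
not be. -/
theorem exists_lift_degree_zero
    {f : (ιF → MvPolynomial σ K) →ₗ[MvPolynomial σ K] (ιA → MvPolynomial σ K)}
    {p : (ιP → MvPolynomial σ K) →ₗ[MvPolynomial σ K] (ιC → MvPolynomial σ K)}
    (hf : IsGradedMap δF δA f) (hp : IsGradedMap δP δC p) (H : AreComparable δA δC f p) :
    ∃ (α : (ιF → MvPolynomial σ K) →ₗ[MvPolynomial σ K] (ιP → MvPolynomial σ K))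
      (β : (ιP → MvPolynomial σ K) →ₗ[MvPolynomial σ K] (ιF → MvPolynomial σ K))
      (h : (ιF → MvPolynomial σ K) →ₗ[MvPolynomial σ K] (ιF → MvPolynomial σ K)),
      IsGradedMap δF δP α ∧ (∀ x, f x = 0 → p (α x) = 0) ∧ (∀ y, p y = 0 → f (β y) = 0) ∧
      (∀ x, f (h x) = 0) ∧ (∀ x, f x = 0 → β (α x) + h x = x) ∧
      ∀ x i, constantCoeff ((β (α x) + h x) i) = constantCoeff (x i) := by
  obtain ⟨a, b, k, ha, hab, hba, hk, hk0⟩ := H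
  obtain ⟨α, hα, hαg⟩ := exists_lift (a ∘ₗ f) p (fun i y => IsHomogVec δP (δF i) y) (fun i => by
    obtain ⟨y, hy⟩ := hab (Pi.single i 1)
    refine ⟨degComp δP (δF i) y, ?_, isHomogVec_degComp _ _ _⟩
    rw [hp.map_degComp, ← hy, ← ha.map_degComp, (hf i).degComp_eq, LinearMap.comp_apply])
  obtain ⟨β, hβ, -⟩ := exists_lift (b ∘ₗ p) f (fun _ _ => True)
    (fun i => (hba (Pi.single i 1)).imp fun x hx => ⟨hx, trivial⟩)
  simp only [LinearMap.comp_apply] at hα hβ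
  -- The defect of `β ∘ α` from the identity, corrected by the homotopy `k`, lands in `ker f` since
  -- `f β α = b a f = f - f k f`.
  refine ⟨α, β, LinearMap.id - β ∘ₗ α - k ∘ₗ f, hαg, fun x hx => ?_, fun y hy => ?_, fun x => ?_,
    fun x hx => ?_, fun x i => ?_⟩
  · rw [hα, hx, map_zero]
  · rw [hβ, hy, map_zero]
  · simp only [LinearMap.sub_apply, LinearMap.comp_apply, LinearMap.id_apply, map_sub, hβ, hα]
    rw [sub_sub, hk, sub_self]
  · simp [hx]
  · simp [hk0]

/-- Inductive step of the comparison: the new homotopy lifts `h` through `f'`, and minimality of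
`f'` kills the constant terms of its composite with `f'`. -/
theorem AreComparable.next
    {f : (ιF → MvPolynomial σ K) →ₗ[MvPolynomial σ K] (ιA → MvPolynomial σ K)}
    {p : (ιP → MvPolynomial σ K) →ₗ[MvPolynomial σ K] (ιC → MvPolynomial σ K)}
    {f' : (ιF' → MvPolynomial σ K) →ₗ[MvPolynomial σ K] (ιF → MvPolynomial σ K)}
    {p' : (ιP' → MvPolynomial σ K) →ₗ[MvPolynomial σ K] (ιP → MvPolynomial σ K)}
    (H : AreComparable δA δC f p) (hf : IsGradedMap δF δA f) (hp : IsGradedMap δP δC p)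
    (hf' : Function.Exact f' f) (hp' : Function.Exact p' p)
    (hmin : ∀ x i, constantCoeff (f' x i) = 0) :
    AreComparable δF δP f' p' := by
  obtain ⟨α, β, h, hα, hfα, hβ, hfh, hid, -⟩ := exists_lift_degree_zero hf hp H
  obtain ⟨k, hk, -⟩ := exists_lift h f' (fun _ _ => True) (fun i => by
    obtain ⟨y, hy⟩ := (hf' _).1 (hfh (Pi.single i 1))
    exact ⟨y, hy.symm, trivial⟩)
  refine ⟨α, β, k, hα, fun x => ?_, fun y => ?_, fun x => ?_,
    fun x i => constantCoeff_map_eq_zero k (hmin x) i⟩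
  · obtain ⟨y, hy⟩ := (hp' _).1 (hfα _ ((hf' _).2 ⟨x, rfl⟩))
    exact ⟨y, hy.symm⟩
  · obtain ⟨x, hx⟩ := (hf' _).1 (hβ _ ((hp' _).2 ⟨y, rfl⟩))
    exact ⟨x, hx.symm⟩
  · rw [hk]
    exact hid _ ((hf' _).2 ⟨x, rfl⟩)

/-- If no basis element of the other resolution had the degree of `e_i`, gradedness would force all
entries of `α e_i` to have zero constant term. Then `β α e_i + h e_i` would too, although its `i`-th
constant term is `1`. -/
theorem AreComparable.exists_degree_eq
    {f : (ιF → MvPolynomial σ K) →ₗ[MvPolynomial σ K] (ιA → MvPolynomial σ K)}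
    {p : (ιP → MvPolynomial σ K) →ₗ[MvPolynomial σ K] (ιC → MvPolynomial σ K)}
    (H : AreComparable δA δC f p) (hf : IsGradedMap δF δA f) (hp : IsGradedMap δP δC p)
    (hker : ∀ x, f x = 0 → ∀ i, constantCoeff (x i) = 0) (i : ιF) :
    ∃ j, δP j = δF i := by
  by_contra! hne
  obtain ⟨α, β, h, hα, -, -, hfh, -, hid⟩ := exists_lift_degree_zero hf hp H
  have h1 := hid (Pi.single i 1) i
  have h2 : ∀ j, constantCoeff (α (Pi.single i 1) j) = 0 := by
    intro j
    by_contra hj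
    obtain ⟨k, hk, hh⟩ := hα i j fun h0 => hj (by rw [h0, map_zero])
    have hk0 : k ≠ 0 := fun h0 => hne j (by omega)
    refine hj (hh.coeff_eq_zero ?_)
    simpa using hk0.symm
  rw [Pi.add_apply, map_add, constantCoeff_map_eq_zero β h2, hker _ (hfh _)] at h1
  simp at h1

theorem areComparable_of_range_eq {ι ιF ιP : Type*} [DecidableEq ι] (δ : ι → ℕ)
    {f : (ιF → MvPolynomial σ K) →ₗ[MvPolynomial σ K] (ι → MvPolynomial σ K)}
    {p : (ιP → MvPolynomial σ K) →ₗ[MvPolynomial σ K] (ι → MvPolynomial σ K)}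
    (h : LinearMap.range f = LinearMap.range p) :
    AreComparable δ δ f p := by
  refine ⟨LinearMap.id, LinearMap.id, 0, fun b a ha => ?_, fun x => ?_, fun y => ?_, by simp,
    by simp⟩
  · obtain rfl : a = b := by
      by_contra hab
      simp [Pi.single_eq_of_ne hab] at ha
    exact ⟨0, rfl, by simpa using isHomogeneous_one σ K⟩
  · obtain ⟨y, hy⟩ : f x ∈ LinearMap.range p := h ▸ ⟨x, rfl⟩
    exact ⟨y, hy.symm⟩
  · obtain ⟨x, hx⟩ : p y ∈ LinearMap.range f := h ▸ ⟨y, rfl⟩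
    exact ⟨x, hx.symm⟩

end Comparison

/-! ### Degrees in a minimal resolution are bounded by any graded resolution of length two. -/

namespace MinimalGradedFreeResolution

variable {K : Type*} [Field K] {n : ℕ} {I : Ideal (MvPolynomial (Fin n) K)}

theorem constantCoeff_d (F : MinimalGradedFreeResolution I) (i : ℕ)
    (x : Fin (F.rank (i + 1)) → MvPolynomial (Fin n) K) (a : Fin (F.rank i)) :
    constantCoeff (F.d i x a) = 0 := by
  rw [map_eq_sum_single (F.d i), Finset.sum_apply, map_sum]
  exact Finset.sum_eq_zero fun b _ => by simp [F.minimal]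

/-- Once `F_i = 0`, exactness makes `F_{i+1}` the image of a minimal differential, so no basis
vector can exist. -/
theorem rank_succ_eq_zero (F : MinimalGradedFreeResolution I) {i : ℕ} (h : F.rank i = 0) :
    F.rank (i + 1) = 0 := by
  by_contra hne
  have hE : IsEmpty (Fin (F.rank i)) := by rw [h]; infer_instance
  let b : Fin (F.rank (i + 1)) := ⟨0, Nat.pos_of_ne_zero hne⟩
  obtain ⟨y, hy⟩ := (F.exact_succ i (Pi.single b 1)).1 (Subsingleton.elim _ _)
  have := F.constantCoeff_d (i + 1) y b
  rw [hy] at this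
  simp at this

theorem betti_ne_zero_iff (F : MinimalGradedFreeResolution I) (i j : ℕ) :
    F.betti i j ≠ 0 ↔ ∃ a, F.deg i a = j := by
  rw [betti, ← Nat.pos_iff_ne_zero, Fintype.card_pos_iff, nonempty_subtype]

/-- The degrees of the basis elements in a minimal resolution occur in every graded free
resolution. -/
theorem exists_degree_eq_of_length_two (F : MinimalGradedFreeResolution I)
    {ι₀ ι₁ ι₂ : Type*} [Fintype ι₀] [Fintype ι₁] [Fintype ι₂] [DecidableEq ι₀] [DecidableEq ι₁]
    [DecidableEq ι₂] {δ₀ : ι₀ → ℕ} {δ₁ : ι₁ → ℕ} {δ₂ : ι₂ → ℕ}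
    (ε : (ι₀ → MvPolynomial (Fin n) K) →ₗ[MvPolynomial (Fin n) K] MvPolynomial (Fin n) K)
    (p₁ : (ι₁ → MvPolynomial (Fin n) K) →ₗ[MvPolynomial (Fin n) K] (ι₀ → MvPolynomial (Fin n) K))
    (p₂ : (ι₂ → MvPolynomial (Fin n) K) →ₗ[MvPolynomial (Fin n) K] (ι₁ → MvPolynomial (Fin n) K))
    (hε : ∀ b, (ε (Pi.single b 1)).IsHomogeneous (δ₀ b)) (h₁ : IsGradedMap δ₁ δ₀ p₁)
    (h₂ : IsGradedMap δ₂ δ₁ p₂) (hI : LinearMap.range ε = I) (hex₁ : Function.Exact p₁ ε)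
    (hex₂ : Function.Exact p₂ p₁) (hinj : Function.Injective p₂) (i j : ℕ)
    (hij : F.betti i j ≠ 0) :
    (i = 0 ∧ ∃ a, δ₀ a = j) ∨ (i = 1 ∧ ∃ a, δ₁ a = j) ∨ (i = 2 ∧ ∃ a, δ₂ a = j) := by
  -- Regarding `S` as free of rank one in degree `0` lets the augmentations start the induction.
  let f₀ := LinearMap.pi fun _ : Fin 1 => F.aug
  let p₀ := LinearMap.pi fun _ : Fin 1 => ε
  have hf₀ : IsGradedMap (F.deg 0) (fun _ => 0) f₀ := fun b a _ =>
    ⟨F.deg 0 b, zero_add _, F.aug_homogeneous b⟩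
  have hp₀ : IsGradedMap δ₀ (fun _ => 0) p₀ := fun b a _ => ⟨δ₀ b, zero_add _, hε b⟩
  have hd : ∀ i, IsGradedMap (F.deg (i + 1)) (F.deg i) (F.d i) := fun i b a =>
    F.d_homogeneous i a b
  have h0 : ∀ x, f₀ x = 0 ↔ F.aug x = 0 := fun x =>
    ⟨fun h => congrFun h 0, fun h => funext fun _ => h⟩
  have h0' : ∀ x, p₀ x = 0 ↔ ε x = 0 := fun x =>
    ⟨fun h => congrFun h 0, fun h => funext fun _ => h⟩
  have hker : ∀ i x, F.d i x = 0 → ∀ a, constantCoeff (x a) = 0 := by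
    intro i x hx
    obtain ⟨y, rfl⟩ := (F.exact_succ i x).1 hx
    exact F.constantCoeff_d _ y
  have hker₀ : ∀ x, f₀ x = 0 → ∀ a, constantCoeff (x a) = 0 := by
    intro x hx
    obtain ⟨y, rfl⟩ := (F.exact_zero x).1 ((h0 x).1 hx)
    exact F.constantCoeff_d _ y
  have H₀ : AreComparable (fun _ => 0) (fun _ => 0) f₀ p₀ := by
    refine areComparable_of_range_eq _ (le_antisymm ?_ ?_)
    · rintro _ ⟨x, rfl⟩
      obtain ⟨y, hy⟩ : F.aug x ∈ LinearMap.range ε := hI.symm ▸ F.range_aug.le ⟨x, rfl⟩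
      exact ⟨y, funext fun _ => hy⟩
    · rintro _ ⟨x, rfl⟩
      obtain ⟨y, hy⟩ : ε x ∈ LinearMap.range F.aug := by
        rw [F.range_aug, ← hI]
        exact ⟨x, rfl⟩
      exact ⟨y, funext fun _ => hy⟩
  have H₁ : AreComparable (F.deg 0) δ₀ (F.d 0) p₁ :=
    H₀.next hf₀ hp₀ (fun x => by rw [h0, F.exact_zero x]) (fun x => by rw [h0', hex₁ x])
      (F.constantCoeff_d 0)
  have H₂ : AreComparable (F.deg 1) δ₁ (F.d 1) p₂ :=
    H₁.next (hd 0) h₁ (F.exact_succ 0) hex₂ (F.constantCoeff_d 1)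
  let p₃ : (Fin 0 → MvPolynomial (Fin n) K) →ₗ[MvPolynomial (Fin n) K]
    (ι₂ → MvPolynomial (Fin n) K) := 0
  have H₃ : AreComparable (F.deg 2) δ₂ (F.d 2) p₃ := by
    refine H₂.next (hd 1) h₂ (F.exact_succ 1) (fun x => ?_) (F.constantCoeff_d 2)
    rw [map_eq_zero_iff p₂ hinj]
    exact ⟨fun h => ⟨0, h.symm⟩, fun ⟨y, hy⟩ => hy.symm⟩
  have hrank : ∀ i, F.rank (i + 3) = 0 := by
    intro i
    induction i with
    | zero =>
      by_contra hne
      -- A basis element of `F_3` would need a partner in the zero module that extends the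
      -- length-two resolution.
      exact (H₃.exists_degree_eq (δP := fun _ => 0) (hd 2) (fun b => b.elim0) (hker 2)
        ⟨0, Nat.pos_of_ne_zero hne⟩).choose.elim0
    | succ i ih => exact F.rank_succ_eq_zero ih
  obtain ⟨a, rfl⟩ := (F.betti_ne_zero_iff i j).1 hij
  match i, a with
  | 0, a => exact Or.inl ⟨rfl, H₀.exists_degree_eq hf₀ hp₀ hker₀ a⟩
  | 1, a => exact Or.inr (Or.inl ⟨rfl, H₁.exists_degree_eq (hd 0) h₁ (hker 0) a⟩)
  | 2, a => exact Or.inr (Or.inr ⟨rfl, H₂.exists_degree_eq (hd 1) h₂ (hker 1) a⟩)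
  | i + 3, a => exact (Fin.cast (hrank i) a).elim0

end MinimalGradedFreeResolution

/-! ### Functions with vanishing fibre sums form a free module. -/

section FibreSums

variable {D T R : Type*} [CommRing R]

/-- A base point of the fibre of `q` through `d`. -/
noncomputable def fibreBase (q : D → T) (d : D) : D := Set.rangeSplitting q ⟨q d, d, rfl⟩

theorem apply_fibreBase (q : D → T) (d : D) : q (fibreBase q d) = q d :=
  Set.apply_rangeSplitting q ⟨q d, d, rfl⟩

theorem fibreBase_congr {q : D → T} {d d' : D} (h : q d = q d') :
    fibreBase q d = fibreBase q d' := by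
  unfold fibreBase
  congr 2

theorem fibreBase_fibreBase (q : D → T) (d : D) :
    fibreBase q (fibreBase q d) = fibreBase q d :=
  fibreBase_congr (apply_fibreBase q d)

variable [Fintype D]

section

variable [DecidableEq T]

/-- The sum of `f` over the fibre of `q` over `v`. -/
def fibreSum (q : D → T) (f : D → R) (v : T) : R := ∑ d with q d = v, f d

theorem sum_fibreSum [Fintype T] (q : D → T) (f : D → R) : ∑ v, fibreSum q f v = ∑ d, f d :=
  Finset.sum_fiberwise _ _ _

theorem sum_mul_fibreSum [Fintype T] (q : D → T) (f : D → R) (w : T → R) :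
    ∑ v, w v * fibreSum q f v = ∑ d, w (q d) * f d := by
  rw [← sum_fibreSum q fun d => w (q d) * f d]
  refine Finset.sum_congr rfl fun v _ => ?_
  rw [fibreSum, fibreSum, Finset.mul_sum]
  refine Finset.sum_congr rfl fun d hd => ?_
  rw [(Finset.mem_filter.1 hd).2]

theorem fibreSum_mul (q : D → T) (f : D → R) (w : T → R) (v : T) :
    fibreSum q (fun d => w (q d) * f d) v = w v * fibreSum q f v := by
  rw [fibreSum, fibreSum, Finset.mul_sum]
  refine Finset.sum_congr rfl fun d hd => ?_
  rw [(Finset.mem_filter.1 hd).2]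

theorem exists_fibreSum_eq (q : D → T) (φ : T → R) (h : ∀ v, v ∉ Set.range q → φ v = 0) :
    ∃ c : D → R, ∀ v, fibreSum q c v = φ v := by
  classical
  -- The whole value over `v` is placed at the base point of the fibre.
  refine ⟨fun d => if fibreBase q d = d then φ (q d) else 0, fun v => ?_⟩
  by_cases hv : v ∈ Set.range q
  · obtain ⟨d, rfl⟩ := hv
    rw [fibreSum, Finset.sum_eq_single (fibreBase q d)]
    · rw [if_pos (fibreBase_fibreBase q d), apply_fibreBase q d]
    · intro d' hd' hne
      rw [if_neg]
      intro h'
      exact hne (h'.symm.trans (fibreBase_congr (Finset.mem_filter.1 hd').2))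
    · intro h'
      exact absurd (Finset.mem_filter.2 ⟨Finset.mem_univ (fibreBase q d), apply_fibreBase q d⟩) h'
  · rw [h v hv]
    refine Finset.sum_eq_zero fun d hd => ?_
    exact absurd ⟨d, (Finset.mem_filter.1 hd).2⟩ hv

end

variable [DecidableEq D]

/-- The points that are not base points of their fibre. -/
abbrev NonBase (q : D → T) : Type _ := {d : D // fibreBase q d ≠ d}

/-- The functions on `D` with vanishing fibre sums, parametrized by their values at the points
that are not base points. -/
noncomputable def fibreExt (q : D → T) : (NonBase q → R) →ₗ[R] (D → R) :=
  Fintype.linearCombination R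
    fun d : NonBase q => (Pi.single d.1 1 - Pi.single (fibreBase q d.1) 1 : D → R)

theorem fibreExt_apply (q : D → T) (f : NonBase q → R) (x : D) :
    fibreExt q f x = ∑ d : NonBase q,
      f d * ((Pi.single d.1 1 : D → R) x - (Pi.single (fibreBase q d.1) 1 : D → R) x) := by
  simp [fibreExt, Fintype.linearCombination_apply]

theorem fibreExt_apply_nonBase (q : D → T) (f : NonBase q → R) (x : NonBase q) :
    fibreExt q f x.1 = f x := by
  rw [fibreExt_apply, Finset.sum_eq_single x]
  · rw [Pi.single_eq_same, Pi.single_eq_of_ne x.2.symm, sub_zero, mul_one]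
  · intro d _ hd
    rw [Pi.single_eq_of_ne (fun h => hd (Subtype.ext h.symm)), Pi.single_eq_of_ne, sub_zero,
      mul_zero]
    intro h
    exact x.2 (by rw [h, fibreBase_fibreBase])
  · simp

theorem isHomogeneous_fibreExt_single {σ K : Type*} [Field K] (q : D → T) (d : NonBase q)
    (x : D) : (fibreExt q (Pi.single d (1 : MvPolynomial σ K)) x).IsHomogeneous 0 := by
  rw [fibreExt, Fintype.linearCombination_apply_single, one_smul, Pi.sub_apply]
  refine IsHomogeneous.sub ?_ ?_ <;>
  · rw [Pi.single_apply]
    split_ifs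
    · exact isHomogeneous_one σ K
    · exact isHomogeneous_zero σ K 0

variable [DecidableEq T]

theorem fibreSum_fibreExt (q : D → T) (f : NonBase q → R) (v : T) :
    fibreSum q (fibreExt q f) v = 0 := by
  simp_rw [fibreSum, fibreExt_apply]
  rw [Finset.sum_comm]
  refine Finset.sum_eq_zero fun d _ => ?_
  rw [← Finset.mul_sum, Finset.sum_sub_distrib]
  simp [Pi.single_apply, apply_fibreBase]

theorem sum_fibreExt [Fintype T] (q : D → T) (f : NonBase q → R) : ∑ d, fibreExt q f d = 0 := by
  rw [← sum_fibreSum q]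
  exact Finset.sum_eq_zero fun v _ => fibreSum_fibreExt q f v

/-- The value at a base point is determined by the others through the vanishing sum, so the
differences `e_d - e_base` span. -/
theorem fibreExt_restrict (q : D → T) (g : D → R) (hg : ∀ v, fibreSum q g v = 0) :
    fibreExt q (fun d => g d.1) = g := by
  have h0 : ∀ x, fibreBase q x ≠ x → fibreExt q (fun d => g d.1) x = g x := fun x hx =>
    fibreExt_apply_nonBase q _ ⟨x, hx⟩
  funext x
  by_cases hx : fibreBase q x = x
  · have h1 := (fibreSum_fibreExt q (fun d => g d.1) (q x)).trans (hg (q x)).symm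
    have hmem : x ∈ Finset.univ.filter fun d => q d = q x := by simp
    rw [fibreSum, fibreSum, ← Finset.add_sum_erase _ _ hmem, ← Finset.add_sum_erase _ g hmem] at h1
    rw [Finset.sum_congr rfl fun d hd => h0 d ?_] at h1
    · exact add_right_cancel h1
    · rw [Finset.mem_erase, Finset.mem_filter] at hd
      rw [fibreBase_congr hd.2.2, hx]
      exact hd.1.symm
  · exact h0 x hx

end FibreSums

/-! ### Ideals generated by variables, and divisibility by a variable. -/

section MvPolynomialLemmas

variable {σ K : Type*} [Field K]

/-- Setting the variables in `T` to zero maps to a domain, has the ideal in its kernel, and changes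
no class modulo the ideal. -/
theorem mem_span_X_image_of_mul_mem [DecidableEq σ] (T : Finset σ) {f u : MvPolynomial σ K}
    (hu : aeval (fun k => if k ∈ T then (0 : MvPolynomial σ K) else X k) u ≠ 0)
    (h : f * u ∈ Ideal.span (X '' (T : Set σ) : Set (MvPolynomial σ K))) :
    f ∈ Ideal.span (X '' (T : Set σ) : Set (MvPolynomial σ K)) := by
  set φ : MvPolynomial σ K →ₐ[K] MvPolynomial σ K :=
    aeval (fun k => if k ∈ T then (0 : MvPolynomial σ K) else X k) with hφ
  set J := Ideal.span (X '' (T : Set σ) : Set (MvPolynomial σ K)) with hJ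
  have h1 : ∀ x ∈ J, φ x = 0 := by
    have : J ≤ RingHom.ker φ := by
      rw [hJ, Ideal.span_le]
      rintro _ ⟨k, hk, rfl⟩
      simp only [SetLike.mem_coe, RingHom.mem_ker, hφ, aeval_X]
      exact if_pos hk
    exact fun x hx => this hx
  have h2 : (Ideal.Quotient.mkₐ K J).comp φ = Ideal.Quotient.mkₐ K J := by
    refine algHom_ext fun k => ?_
    rw [AlgHom.comp_apply, hφ, aeval_X]
    split_ifs with hk
    · rw [map_zero]
      exact (Ideal.Quotient.eq_zero_iff_mem.2
      (Ideal.subset_span (Set.mem_image_of_mem X (Finset.mem_coe.2 hk)))).symm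
    · rfl
  have h3 : φ f = 0 := by
    have := h1 _ h
    rw [map_mul] at this
    exact (mul_eq_zero.1 this).resolve_right hu
  have h4 := DFunLike.congr_fun h2 f
  rw [AlgHom.comp_apply, h3, map_zero] at h4
  exact Ideal.Quotient.eq_zero_iff_mem.1 h4.symm

theorem X_dvd_prod_X_iff [DecidableEq σ] (i : σ) (s : Finset σ) :
    (X i : MvPolynomial σ K) ∣ ∏ k ∈ s, X k ↔ i ∈ s := by
  refine ⟨fun h => ?_, fun h => Finset.dvd_prod_of_mem _ h⟩
  obtain ⟨k, hk, h⟩ := (X_prime (R := K) (i := i)).exists_mem_finset_dvd h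
  rwa [X_dvd_X.1 h]

end MvPolynomialLemmas

/-! ### The explicit resolution of length two. -/

section EdgeResolution

set_option linter.unusedSectionVars false

variable {V : Type*} [Fintype V] [DecidableEq V] (K : Type*) [Field K]
  {E : Type*} [Fintype E] [DecidableEq E] (ends : E → Bool → V)

/-- The product of the variables outside the ends of the edge `e`. -/
noncomputable def coedgeMonomial (e : E) : MvPolynomial V K :=
  ∏ k ∈ ({ends e true, ends e false} : Finset V)ᶜ, X k

/-- The product of the variables other than `X v`. -/
noncomputable def covertexMonomial (v : V) : MvPolynomial V K := ∏ k ∈ ({v} : Finset V)ᶜ, X k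

/-- The vertex at which the dart `d` is based. -/
abbrev dartVertex (d : E × Bool) : V := ends d.1 d.2

/-- The augmentation of the resolution of a complementary edge ideal. -/
noncomputable def edgeAug : (E → MvPolynomial V K) →ₗ[MvPolynomial V K] MvPolynomial V K :=
  Fintype.linearCombination _ (coedgeMonomial K ends)

/-- The element of the free module on the edges given by functions on the darts and on the
edges. -/
noncomputable def edgeCombine :
    (E × Bool → MvPolynomial V K) × (E → MvPolynomial V K) →ₗ[MvPolynomial V K]
      (E → MvPolynomial V K) where
  toFun f e := X (ends e false) * f.1 (e, true) + X (ends e true) * f.1 (e, false) +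
    X (ends e true) * X (ends e false) * f.2 e
  map_add' f g := by
    funext e
    simp only [Prod.fst_add, Prod.snd_add, Pi.add_apply]
    ring
  map_smul' c f := by
    funext e
    simp only [Prod.smul_fst, Prod.smul_snd, Pi.smul_apply, smul_eq_mul, RingHom.id_apply]
    ring

theorem edgeCombine_apply (f : E × Bool → MvPolynomial V K) (g : E → MvPolynomial V K) (e : E) :
    edgeCombine K ends (f, g) e = X (ends e false) * f (e, true) +
      X (ends e true) * f (e, false) + X (ends e true) * X (ends e false) * g e := rfl

/-- The first differential of the resolution of a complementary edge ideal. -/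
noncomputable def edgeD₁ :
    (NonBase (dartVertex ends) ⊕ NonBase (fun _ : E => ()) → MvPolynomial V K)
      →ₗ[MvPolynomial V K] (E → MvPolynomial V K) :=
  edgeCombine K ends ∘ₗ LinearMap.prod
    (fibreExt (dartVertex ends) ∘ₗ LinearMap.funLeft _ _ Sum.inl)
    (fibreExt (fun _ : E => ()) ∘ₗ LinearMap.funLeft _ _ Sum.inr)

theorem edgeD₁_apply
    (y : NonBase (dartVertex ends) ⊕ NonBase (fun _ : E => ()) → MvPolynomial V K) :
    edgeD₁ K ends y = edgeCombine K ends (fibreExt (dartVertex ends) fun d => y (Sum.inl d),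
      fibreExt (fun _ : E => ()) fun e => y (Sum.inr e)) := rfl

/-- The second differential of the resolution of a complementary edge ideal. -/
noncomputable def edgeD₂ :
    (NonBase (dartVertex ends) → MvPolynomial V K) →ₗ[MvPolynomial V K]
      (NonBase (dartVertex ends) ⊕ NonBase (fun _ : E => ()) → MvPolynomial V K) where
  toFun h := Sum.elim (fun d => X (dartVertex ends d.1) * h d) fun e =>
    -(fibreExt (dartVertex ends) h (e.1, true) + fibreExt (dartVertex ends) h (e.1, false))
  map_add' f g := by
    funext x
    cases x
    · simp [mul_add]
    · simp only [Sum.elim_inr, map_add, Pi.add_apply]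
      ring
  map_smul' c f := by
    funext x
    cases x
    · simp only [Sum.elim_inl, Pi.smul_apply, smul_eq_mul, RingHom.id_apply]
      ring
    · simp only [Sum.elim_inr, map_smul, Pi.smul_apply, smul_eq_mul, RingHom.id_apply]
      ring

theorem edgeD₂_injective : Function.Injective (edgeD₂ K ends) := by
  rw [injective_iff_map_eq_zero]
  intro h hh
  funext d
  have := congrFun hh (Sum.inl d)
  exact (mul_eq_zero.1 this).resolve_left (X_ne_zero _)

theorem fibreSum_unit {R : Type*} [CommRing R] (g : E → R) (v : Unit) :
    fibreSum (fun _ : E => ()) g v = ∑ e, g e := by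
  simp [fibreSum]

theorem sum_darts {R : Type*} [CommRing R] (f : E × Bool → R) :
    ∑ d, f d = ∑ e, (f (e, true) + f (e, false)) := by
  rw [Fintype.sum_prod_type]
  simp

theorem edgeD₁_restrict (f : E × Bool → MvPolynomial V K) (g : E → MvPolynomial V K)
    (hf : ∀ v, fibreSum (dartVertex ends) f v = 0) (hg : ∑ e, g e = 0) :
    edgeD₁ K ends (Sum.elim (fun d => f d.1) fun e => g e.1) = edgeCombine K ends (f, g) := by
  rw [edgeD₁_apply]
  simp only [Sum.elim_inl, Sum.elim_inr]
  rw [fibreExt_restrict _ f hf, fibreExt_restrict _ g fun v => (fibreSum_unit g v).trans hg]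

/-- A relation at `e` forces the value at each dart to be divisible by the variable of its vertex.
The quotients still have zero fibre sums and determine the edge part. -/
theorem edgeD₁_exact (hne : ∀ e, ends e true ≠ ends e false) :
    Function.Exact (edgeD₂ K ends) (edgeD₁ K ends) := by
  intro y
  constructor
  · intro hy
    have h1 : ∀ e, X (ends e false) * fibreExt (dartVertex ends) (fun d => y (Sum.inl d)) (e, true) +
        X (ends e true) * fibreExt (dartVertex ends) (fun d => y (Sum.inl d)) (e, false) +
        X (ends e true) * X (ends e false) * fibreExt (fun _ : E => ()) (fun e => y (Sum.inr e)) e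
          = 0 := fun e => congrFun hy e
    have hf := fibreSum_fibreExt (dartVertex ends) fun d => y (Sum.inl d)
    have hf0 := fibreExt_apply_nonBase (dartVertex ends) fun d => y (Sum.inl d)
    have hg0 := fibreExt_apply_nonBase (fun _ : E => ()) fun e => y (Sum.inr e)
    generalize fibreExt (dartVertex ends) (fun d => y (Sum.inl d)) = f at *
    generalize fibreExt (fun _ : E => ()) (fun e => y (Sum.inr e)) = g at *
    have hdvd : ∀ d, X (dartVertex ends d) ∣ f d := by
      have key : ∀ (v w : V) (a b c : MvPolynomial V K), v ≠ w →
          X w * a + X v * b + X v * X w * c = 0 → X v ∣ a := by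
        intro v w a b c hvw h
        refine ((X_prime (R := K) (i := v)).dvd_or_dvd (a := X w) ?_).resolve_left
          fun h => hvw (X_dvd_X.1 h)
        exact ⟨-(b + X w * c), by linear_combination h⟩
      rintro ⟨e, _ | _⟩
      · exact key (ends e false) (ends e true) (f (e, false)) (f (e, true)) (g e) (hne e).symm
          (by linear_combination h1 e)
      · exact key _ _ _ _ _ (hne e) (h1 e)
    choose f' hf' using hdvd
    have hf's : ∀ v, fibreSum (dartVertex ends) f' v = 0 := by
      intro v
      have := hf v
      rw [funext hf', fibreSum_mul (dartVertex ends) f' X v] at this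
      exact (mul_eq_zero.1 this).resolve_left (X_ne_zero _)
    refine ⟨fun d => f' d.1, ?_⟩
    funext x
    rcases x with d | e
    · change X (dartVertex ends d.1) * f' d.1 = _
      rw [← hf', hf0]
    · change -(fibreExt (dartVertex ends) (fun d => f' d.1) (e.1, true) +
        fibreExt (dartVertex ends) (fun d => f' d.1) (e.1, false)) = _
      rw [fibreExt_restrict _ f' hf's, ← hg0]
      have h2 := h1 e.1
      rw [hf' (e.1, true), hf' (e.1, false)] at h2
      refine mul_left_cancel₀ (mul_ne_zero (X_ne_zero (ends e.1 true))
        (X_ne_zero (R := K) (ends e.1 false))) ?_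
      linear_combination -h2
  · rintro ⟨h, rfl⟩
    have := edgeD₁_restrict K ends (fun d => X (dartVertex ends d) * fibreExt (dartVertex ends) h d)
      (fun e => -(fibreExt (dartVertex ends) h (e, true) + fibreExt (dartVertex ends) h (e, false)))
      (fun v => by rw [fibreSum_mul _ _ X, fibreSum_fibreExt, mul_zero])
      (by rw [Finset.sum_neg_distrib, ← sum_darts, sum_fibreExt, neg_zero])
    simp only [fibreExt_apply_nonBase] at this
    refine Eq.trans this (funext fun e => ?_)
    rw [edgeCombine_apply, Pi.zero_apply]
    ring

theorem edgeAug_apply (f : E → MvPolynomial V K) :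
    edgeAug K ends f = ∑ e, f e * coedgeMonomial K ends e := rfl

variable {ends}

theorem X_mul_coedgeMonomial_true (hne : ∀ e, ends e true ≠ ends e false) (e : E) :
    X (ends e true) * coedgeMonomial K ends e = covertexMonomial K (ends e false) := by
  rw [coedgeMonomial, covertexMonomial, ← Finset.prod_insert (by simp)]
  congr 1
  ext k
  have := hne e
  simp only [Finset.mem_insert, Finset.mem_compl, Finset.mem_singleton]
  grind

theorem X_mul_coedgeMonomial_false (hne : ∀ e, ends e true ≠ ends e false) (e : E) :
    X (ends e false) * coedgeMonomial K ends e = covertexMonomial K (ends e true) := by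
  rw [coedgeMonomial, covertexMonomial, ← Finset.prod_insert (by simp)]
  congr 1
  ext k
  have := hne e
  simp only [Finset.mem_insert, Finset.mem_compl, Finset.mem_singleton]
  grind

theorem X_mul_covertexMonomial (v : V) : X v * covertexMonomial K v = ∏ k, X k := by
  rw [covertexMonomial, ← Finset.prod_insert (by simp)]
  congr 1
  ext k
  simp only [Finset.mem_insert, Finset.mem_compl, Finset.mem_singleton, Finset.mem_univ]
  grind

theorem edgeAug_edgeCombine (hne : ∀ e, ends e true ≠ ends e false)
    (f : E × Bool → MvPolynomial V K) (g : E → MvPolynomial V K) :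
    edgeAug K ends (edgeCombine K ends (f, g)) =
      ∑ v, covertexMonomial K v * fibreSum (dartVertex ends) f v +
        (∏ k, X k) * ∑ e, g e := by
  rw [sum_mul_fibreSum, sum_darts, Finset.mul_sum, ← Finset.sum_add_distrib, edgeAug_apply]
  refine Finset.sum_congr rfl fun e _ => ?_
  rw [edgeCombine_apply, ← X_mul_covertexMonomial K (ends e true)]
  dsimp only [dartVertex]
  rw [← X_mul_coedgeMonomial_false K hne, ← X_mul_coedgeMonomial_true K hne]
  ring

theorem edgeAug_exact (hne : ∀ e, ends e true ≠ ends e false)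
    (hinj : ∀ e e', e' ≠ e → ∃ b, ∀ b', ends e b ≠ ends e' b') :
    Function.Exact (edgeD₁ K ends) (edgeAug K ends) := by
  intro f
  constructor
  · intro hf
    have hdec : ∀ e, ∃ a b, f e = X (ends e false) * a + X (ends e true) * b := by
      intro e
      -- Every other edge misses an end of `e`, so its generator is divisible by the variable of
      -- that end.
      have hmem : f e * coedgeMonomial K ends e ∈ Ideal.span
          (X '' (({ends e true, ends e false} : Finset V) : Set V) : Set (MvPolynomial V K)) := by
        rw [edgeAug_apply, ← Finset.add_sum_erase _ _ (Finset.mem_univ e)] at hf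
        rw [eq_neg_of_add_eq_zero_left hf]
        refine Ideal.neg_mem_iff _ |>.2 (Ideal.sum_mem _ fun e' he' => Ideal.mul_mem_left _ _ ?_)
        obtain ⟨b, hb⟩ := hinj e e' (Finset.ne_of_mem_erase he')
        refine Ideal.mem_of_dvd _ ((X_dvd_prod_X_iff (ends e b) _).2 ?_)
          (Ideal.subset_span ⟨ends e b, ?_, rfl⟩)
        · simpa using ⟨hb true, hb false⟩
        · cases b <;> simp
      have h1 := mem_span_X_image_of_mul_mem _ ?_ hmem
      · rw [Finset.coe_pair, Set.image_pair, Ideal.mem_span_pair] at h1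
        obtain ⟨a, b, h⟩ := h1
        exact ⟨b, a, by rw [← h]; ring⟩
      · rw [coedgeMonomial, map_prod]
        refine Finset.prod_ne_zero_iff.2 fun k hk => ?_
        rw [aeval_X, if_neg (Finset.mem_compl.1 hk)]
        exact X_ne_zero k
    choose a b hab using hdec
    set g : E × Bool → MvPolynomial V K := fun d => if d.2 then a d.1 else b d.1 with hg
    have hfg : f = edgeCombine K ends (g, 0) := by
      funext e
      rw [edgeCombine_apply, hab e]
      simp [hg]
    rw [hfg, edgeAug_edgeCombine K hne] at hf
    simp only [Pi.zero_apply, Finset.sum_const_zero, mul_zero, add_zero] at hf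
    have hdvd : ∀ v, X v ∣ fibreSum (dartVertex ends) g v := by
      intro v
      rw [← Finset.add_sum_erase _ _ (Finset.mem_univ v)] at hf
      refine ((X_prime (R := K) (i := v)).dvd_or_dvd (a := covertexMonomial K v) ?_).resolve_left ?_
      · rw [eq_neg_of_add_eq_zero_left hf, dvd_neg]
        refine Finset.dvd_sum fun w hw => Dvd.dvd.mul_right ?_ _
        refine (X_dvd_prod_X_iff v _).2 ?_
        simpa using (Finset.ne_of_mem_erase hw).symm
      · rw [covertexMonomial, X_dvd_prod_X_iff]
        simp
    choose t ht using hdvd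
    have ht0 : ∑ v, t v = 0 := by
      simp_rw [ht, ← mul_assoc, mul_comm (covertexMonomial K _), X_mul_covertexMonomial] at hf
      rw [← Finset.mul_sum] at hf
      exact (mul_eq_zero.1 hf).resolve_left (Finset.prod_ne_zero_iff.2 fun k _ => X_ne_zero k)
    -- At an isolated vertex the fibre is empty, so `t v = 0` and the lift `c` still exists.
    obtain ⟨c, hc⟩ := exists_fibreSum_eq (dartVertex ends) t fun v hv => by
      have h0 : fibreSum (dartVertex ends) g v = 0 :=
        Finset.sum_eq_zero fun d hd => absurd ⟨d, (Finset.mem_filter.1 hd).2⟩ hv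
      rw [ht] at h0
      exact (mul_eq_zero.1 h0).resolve_left (X_ne_zero _)
    -- Subtracting `x_v c` on the darts removes the fibre sums `x_v t_v`; the edge term restores the
    -- same element `f`.
    refine ⟨_, (edgeD₁_restrict K ends (fun d => g d - X (dartVertex ends d) * c d)
      (fun e => c (e, true) + c (e, false)) (fun v => ?_) ?_).trans ?_⟩
    · have h1 := fibreSum_mul (dartVertex ends) c X v
      rw [hc, ← ht] at h1
      rw [fibreSum, Finset.sum_sub_distrib]
      exact sub_eq_zero.2 h1.symm
    · rw [← sum_darts, ← sum_fibreSum (dartVertex ends)]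
      simp_rw [hc, ht0]
    · rw [hfg]
      funext e
      rw [edgeCombine_apply, edgeCombine_apply, Pi.zero_apply]
      ring
  · rintro ⟨y, rfl⟩
    rw [edgeD₁_apply, edgeAug_edgeCombine K hne]
    simp_rw [fibreSum_fibreExt, sum_fibreExt]
    simp

theorem isHomogeneous_edgeAug (hne : ∀ e, ends e true ≠ ends e false) (e : E) :
    (edgeAug K ends (Pi.single e 1)).IsHomogeneous (Fintype.card V - 2) := by
  rw [edgeAug, Fintype.linearCombination_apply_single, one_smul, coedgeMonomial]
  have h := IsHomogeneous.prod ({ends e true, ends e false} : Finset V)ᶜ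
    (fun k => (X k : MvPolynomial V K)) (fun _ => 1) fun k _ => isHomogeneous_X K k
  rwa [Finset.sum_const, smul_eq_mul, mul_one, Finset.card_compl, Finset.card_pair (hne e)] at h

theorem isGradedMap_edgeD₁ (m : ℕ) :
    IsGradedMap (Sum.elim (fun _ => m + 1) fun _ => m + 2) (fun _ => m) (edgeD₁ K ends) := by
  have hdeg : ∀ v, (X v : MvPolynomial V K).IsHomogeneous 1 := isHomogeneous_X K
  rintro (d | e) x -
  · refine ⟨1, rfl, ?_⟩
    have h1 : (fun d' => (Pi.single (Sum.inl d) 1 : _ ⊕ NonBase (fun _ : E => ()) →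
        MvPolynomial V K) (Sum.inl d')) = Pi.single d 1 := by
      funext d'
      simp [Pi.single_apply]
    have h2 : (fun e' => (Pi.single (Sum.inl d) 1 : _ ⊕ NonBase (fun _ : E => ()) →
        MvPolynomial V K) (Sum.inr e')) = 0 := by
      funext d'
      simp
    rw [edgeD₁_apply, h1, h2, map_zero, edgeCombine_apply, Pi.zero_apply, mul_zero, add_zero]
    exact ((hdeg _).mul (isHomogeneous_fibreExt_single _ d _)).add
      ((hdeg _).mul (isHomogeneous_fibreExt_single _ d _))
  · refine ⟨2, rfl, ?_⟩
    have h1 : (fun d' => (Pi.single (Sum.inr e) 1 : NonBase (dartVertex ends) ⊕ _ →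
        MvPolynomial V K) (Sum.inl d')) = 0 := by
      funext d'
      simp
    have h2 : (fun e' => (Pi.single (Sum.inr e) 1 : NonBase (dartVertex ends) ⊕ _ →
        MvPolynomial V K) (Sum.inr e')) = Pi.single e 1 := by
      funext d'
      simp [Pi.single_apply]
    rw [edgeD₁_apply, h1, h2, map_zero, edgeCombine_apply, Pi.zero_apply, Pi.zero_apply, mul_zero,
      mul_zero, zero_add, zero_add]
    exact ((hdeg _).mul (hdeg _)).mul (isHomogeneous_fibreExt_single _ e _)

/-- The block into the edge part has constant entries, so the resolution need not be minimal. -/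
theorem isGradedMap_edgeD₂ (m : ℕ) :
    IsGradedMap (fun _ => m + 2) (Sum.elim (fun _ => m + 1) fun _ => m + 2) (edgeD₂ K ends) := by
  rintro d (d' | e) -
  · refine ⟨1, rfl, ?_⟩
    change (X _ * (Pi.single d 1 : _ → MvPolynomial V K) d').IsHomogeneous (1 + 0)
    refine (isHomogeneous_X K _).mul ?_
    rw [Pi.single_apply]
    split_ifs
    · exact isHomogeneous_one V K
    · exact isHomogeneous_zero V K 0
  · refine ⟨0, rfl, ?_⟩
    exact ((isHomogeneous_fibreExt_single _ d _).add (isHomogeneous_fibreExt_single _ d _)).neg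

end EdgeResolution

/-! ### Application to the complementary edge ideal: Betti numbers. -/

section ComplementaryEdgeIdeal

/-- The edges of a graph on `n` vertices, as increasing pairs. -/
abbrev OrderedEdge {n : ℕ} (G : SimpleGraph (Fin n)) : Type :=
  {p : Fin n × Fin n // p.1 < p.2 ∧ G.Adj p.1 p.2}

/-- The ends of an edge. -/
def orderedEnds {n : ℕ} (G : SimpleGraph (Fin n)) (e : OrderedEdge G) (b : Bool) : Fin n :=
  if b then e.1.1 else e.1.2

variable (K : Type*) [Field K] {n : ℕ} (G : SimpleGraph (Fin n))

theorem orderedEnds_ne (e : OrderedEdge G) : orderedEnds G e true ≠ orderedEnds G e false := by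
  simpa [orderedEnds] using e.2.1.ne

theorem exists_orderedEnds_ne (e e' : OrderedEdge G) (h : e' ≠ e) :
    ∃ b, ∀ b', orderedEnds G e b ≠ orderedEnds G e' b' := by
  by_contra hne
  have hcon : ∀ b, ∃ b', orderedEnds G e b = orderedEnds G e' b' := by
    intro b
    by_contra hb
    exact hne ⟨b, fun b' h' => hb ⟨b', h'⟩⟩
  obtain ⟨b, hb⟩ := hcon true
  obtain ⟨c, hc⟩ := hcon false
  revert h hb hc
  clear hcon hne
  obtain ⟨⟨i, j⟩, hij, -⟩ := e
  obtain ⟨⟨i', j'⟩, hij', -⟩ := e'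
  intro h hb hc
  simp only [orderedEnds] at hb hc hij hij'
  refine h (Subtype.ext (Prod.ext ?_ ?_)) <;> cases b <;> cases c <;> simp at hb hc ⊢ <;> omega

variable [Fintype (OrderedEdge G)]

theorem range_edgeAug :
    LinearMap.range (edgeAug K (orderedEnds G)) = complementaryEdgeIdeal K G := by
  rw [edgeAug, Fintype.range_linearCombination, complementaryEdgeIdeal]
  refine congrArg (Submodule.span _) ?_
  ext u
  constructor
  · rintro ⟨e, rfl⟩
    exact ⟨e.1.1, e.1.2, e.2.2, rfl⟩
  · rintro ⟨i, j, hij, rfl⟩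
    rcases lt_or_gt_of_ne hij.ne with h | h
    · exact ⟨⟨(i, j), h, hij⟩, rfl⟩
    · refine ⟨⟨(j, i), h, hij.symm⟩, ?_⟩
      rw [Finset.pair_comm i j]
      rfl

theorem betti_complementaryEdgeIdeal (hn : 4 ≤ n)
    (F : MinimalGradedFreeResolution (complementaryEdgeIdeal K G)) (i j : ℕ)
    (h : F.betti i j ≠ 0) :
    (i, j) ∈ ({(0, n - 2), (1, n - 1), (1, n), (2, n)} : Set (ℕ × ℕ)) := by
  classical
  have key := F.exists_degree_eq_of_length_two (edgeAug K (orderedEnds G))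
    (edgeD₁ K (orderedEnds G)) (edgeD₂ K (orderedEnds G))
    (isHomogeneous_edgeAug K (orderedEnds_ne G)) (isGradedMap_edgeD₁ K _) (isGradedMap_edgeD₂ K _)
    (range_edgeAug K G) (edgeAug_exact K (orderedEnds_ne G) (exists_orderedEnds_ne G))
    (edgeD₁_exact K _ (orderedEnds_ne G)) (edgeD₂_injective K _) i j h
  rw [Fintype.card_fin] at key
  have h1 : n - 2 + 1 = n - 1 := by omega
  have h2 : n - 2 + 2 = n := by omega
  rw [h1, h2] at key
  simp only [Set.mem_insert_iff, Set.mem_singleton_iff, Prod.mk.injEq]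
  rcases key with ⟨rfl, a, rfl⟩ | ⟨rfl, a, rfl⟩ | ⟨rfl, a, rfl⟩
  · simp
  · rcases a with a | a <;> simp
  · simp

end ComplementaryEdgeIdeal

/-! ### Bounds for the projective dimension. -/

section ProjectiveDimension

open CategoryTheory

universe u

theorem hasProjectiveDimensionLT_succ_of_exact {R : Type u} [CommRing R] {A B C : Type u}
    [AddCommGroup A] [AddCommGroup B] [AddCommGroup C] [Module R A] [Module R B] [Module R C]
    (f : A →ₗ[R] B) (g : B →ₗ[R] C) (hf : Function.Injective f) (hfg : Function.Exact f g)
    (hg : Function.Surjective g) [Module.Projective R B] (m : ℕ)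
    (hA : HasProjectiveDimensionLT (ModuleCat.of R A) (m + 1)) :
    HasProjectiveDimensionLT (ModuleCat.of R C) (m + 2) := by
  let S : ShortComplex (ModuleCat.{u} R) :=
    ShortComplex.mk (ModuleCat.ofHom f) (ModuleCat.ofHom g)
      (ModuleCat.hom_ext (LinearMap.ext fun x => (hfg _).2 ⟨x, rfl⟩))
  have hS : S.ShortExact := ModuleCat.shortComplex_shortExact S hfg hf hg
  have hB : Projective (ModuleCat.of R B) := (IsProjective.iff_projective B).1 inferInstance
  exact (hS.hasProjectiveDimensionLT_X₃_iff m hB).2 hA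

theorem hasProjectiveDimensionLE_two_of_exact {R : Type u} [CommRing R] {A B C D : Type u}
    [AddCommGroup A] [AddCommGroup B] [AddCommGroup C] [AddCommGroup D] [Module R A] [Module R B]
    [Module R C] [Module R D] [Module.Projective R A] [Module.Projective R B]
    [Module.Projective R C] (f : A →ₗ[R] B) (g : B →ₗ[R] C) (h : C →ₗ[R] D)
    (hf : Function.Injective f) (hfg : Function.Exact f g) (hgh : Function.Exact g h)
    (hh : Function.Surjective h) : HasProjectiveDimensionLE (ModuleCat.of R D) 2 := by
  have hA : Projective (ModuleCat.of R A) := (IsProjective.iff_projective A).1 inferInstance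
  refine hasProjectiveDimensionLT_succ_of_exact (LinearMap.range g).subtype h
    (Submodule.subtype_injective _) (fun x => ?_) hh 1
    (hasProjectiveDimensionLT_succ_of_exact f g.rangeRestrict hf (fun x => ?_)
      g.surjective_rangeRestrict 0 inferInstance)
  · rw [hgh x]
    exact ⟨fun ⟨y, hy⟩ => ⟨⟨x, y, hy⟩, rfl⟩, fun ⟨y, hy⟩ => hy ▸ y.2⟩
  · rw [← hfg x, ← Subtype.coe_inj]
    rfl

/-- A section `s` of the free cover of `I` satisfies `w s(u) = u s(w)`, so `p` divides every
coordinate of `s(u)` and can be cancelled inside `I`. -/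
theorem exists_eq_mul_of_projective {R : Type*} [CommRing R] (I : Ideal R)
    [Module.Projective R I] {p u w : R} (hp : Prime p) (hu : u ∈ I) (hw : w ∈ I) (hpu : p ∣ u)
    (hpw : ¬ p ∣ w) : ∃ y ∈ I, u = p * y := by
  obtain ⟨s, hs⟩ := (Module.projective_def' (R := R) (P := I)).1 inferInstance
  have hdvd : ∀ k, p ∣ s ⟨u, hu⟩ k := by
    intro k
    have h1 : w • s ⟨u, hu⟩ = u • s ⟨w, hw⟩ := by
      rw [← map_smul, ← map_smul]
      exact congrArg s (Subtype.ext (mul_comm w u))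
    have h2 : w * s ⟨u, hu⟩ k = u * s ⟨w, hw⟩ k := DFunLike.congr_fun h1 k
    exact (hp.dvd_or_dvd (h2 ▸ hpu.mul_right _)).resolve_left hpw
  choose c hc using hdvd
  have h3 := congrArg Subtype.val (LinearMap.congr_fun hs ⟨u, hu⟩)
  rw [LinearMap.comp_apply, Finsupp.linearCombination_apply, Finsupp.sum,
    Submodule.coe_sum] at h3
  refine ⟨∑ k ∈ (s ⟨u, hu⟩).support, c k * k,
    Ideal.sum_mem _ fun k _ => I.mul_mem_left _ k.2, ?_⟩
  rw [Finset.mul_sum]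
  refine h3.symm.trans (Finset.sum_congr rfl fun k _ => ?_)
  rw [← mul_assoc, ← hc]
  rfl

variable {K : Type u} [Field K] {n : ℕ} (G : SimpleGraph (Fin n))

theorem projectiveDimension_complementaryEdgeIdeal_le :
    projectiveDimension (ModuleCat.of (MvPolynomial (Fin n) K) (complementaryEdgeIdeal K G)) ≤
      2 := by
  classical
  have hle := range_edgeAug K G
  let ε : (OrderedEdge G → MvPolynomial (Fin n) K) →ₗ[MvPolynomial (Fin n) K]
      complementaryEdgeIdeal K G :=
    (edgeAug K (orderedEnds G)).codRestrict _ fun x => hle.le ⟨x, rfl⟩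
  have h := hasProjectiveDimensionLE_two_of_exact (edgeD₂ K (orderedEnds G))
    (edgeD₁ K (orderedEnds G)) ε (edgeD₂_injective K _) (edgeD₁_exact K _ (orderedEnds_ne G))
    (fun x => by
      rw [← edgeAug_exact K (orderedEnds_ne G) (exists_orderedEnds_ne G) x, ← Subtype.coe_inj]
      rfl)
    (fun y => by
      obtain ⟨x, hx⟩ := hle.ge y.2
      exact ⟨x, Subtype.ext hx⟩)
  exact_mod_cast (projectiveDimension_le_iff _ 2).2 h

/-- Projectivity would put `P / (x_i x_a x_b)` in the ideal. Each generator omits only two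
variables, so setting `x_i, x_a, x_b` to zero kills the ideal but not this monomial. -/
theorem not_projective_complementaryEdgeIdeal {a b i j : Fin n} (hab : G.Adj a b)
    (hij : G.Adj i j) (hia : i ≠ a) (hib : i ≠ b) :
    ¬ Module.Projective (MvPolynomial (Fin n) K) (complementaryEdgeIdeal K G) := by
  intro hproj
  obtain ⟨y, hy, hxy⟩ := exists_eq_mul_of_projective (complementaryEdgeIdeal K G)
    (X_prime (R := K) (i := i)) (Ideal.subset_span ⟨a, b, hab, rfl⟩)
    (Ideal.subset_span ⟨i, j, hij, rfl⟩) ((X_dvd_prod_X_iff _ _).2 (by simp [hia, hib]))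
    (by rw [X_dvd_prod_X_iff]; simp)
  have hy' : y = ∏ k ∈ ({i, a, b} : Finset (Fin n))ᶜ, X k := by
    refine mul_left_cancel₀ (X_ne_zero (R := K) i) (hxy.symm.trans ?_)
    rw [← Finset.prod_insert (by simp)]
    refine Finset.prod_congr ?_ fun _ _ => rfl
    ext k
    simp only [Finset.mem_insert, Finset.mem_compl, Finset.mem_singleton]
    grind
  let φ : MvPolynomial (Fin n) K →ₐ[K] MvPolynomial (Fin n) K :=
    aeval fun k => if k ∈ ({i, a, b} : Finset (Fin n)) then 0 else X k
  have hφ : complementaryEdgeIdeal K G ≤ RingHom.ker φ := by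
    rw [complementaryEdgeIdeal, Ideal.span_le]
    rintro _ ⟨c, d, -, rfl⟩
    rw [SetLike.mem_coe, RingHom.mem_ker, map_prod]
    obtain ⟨k, hk, hk'⟩ : ∃ k ∈ ({i, a, b} : Finset (Fin n)), k ∉ ({c, d} : Finset (Fin n)) := by
      refine Finset.exists_mem_notMem_of_card_lt_card (lt_of_le_of_lt Finset.card_le_two ?_)
      rw [Finset.card_eq_three.2 ⟨i, a, b, hia, hib, hab.ne, rfl⟩]
      norm_num
    refine Finset.prod_eq_zero (Finset.mem_compl.2 hk') ?_
    rw [aeval_X, if_pos hk]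
  have h0 : φ y = 0 := hφ hy
  rw [hy', map_prod] at h0
  refine Finset.prod_ne_zero_iff.2 (fun k hk => ?_) h0
  rw [aeval_X, if_neg (Finset.mem_compl.1 hk)]
  exact X_ne_zero k

theorem one_le_projectiveDimension_complementaryEdgeIdeal (hn : 3 ≤ n)
    (hG : ∀ v, ∃ w, G.Adj v w) :
    1 ≤ projectiveDimension
      (ModuleCat.of (MvPolynomial (Fin n) K) (complementaryEdgeIdeal K G)) := by
  obtain ⟨a⟩ : Nonempty (Fin n) := ⟨⟨0, by omega⟩⟩
  obtain ⟨b, hab⟩ := hG a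
  obtain ⟨i, -, hi⟩ : ∃ i ∈ (Finset.univ : Finset (Fin n)),
      i ∉ ({a, b} : Finset (Fin n)) := by
    refine Finset.exists_mem_notMem_of_card_lt_card (lt_of_le_of_lt Finset.card_le_two ?_)
    rw [Finset.card_univ, Fintype.card_fin]
    omega
  obtain ⟨j, hij⟩ := hG i
  simp only [Finset.mem_insert, Finset.mem_singleton, not_or] at hi
  have h := not_projective_complementaryEdgeIdeal (K := K) G hab hij hi.1 hi.2
  rw [IsProjective.iff_projective, projective_iff_hasProjectiveDimensionLT_one] at h
  exact_mod_cast (projectiveDimension_ge_iff _ 1).2 h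

end ProjectiveDimension

/-- The admissible pairs give only `j - i = n - 2` or `n - 1`. An edge makes the ideal nonzero, so
`F_0 ≠ 0` and `n - 2` is attained. -/
theorem exists_isRegularity_complementaryEdgeIdeal {K : Type*} [Field K] {n : ℕ} (hn : 4 ≤ n)
    (G : SimpleGraph (Fin n)) (hG : ∃ v w, G.Adj v w)
    (F : MinimalGradedFreeResolution (complementaryEdgeIdeal K G)) :
    ∃ r : ℤ, F.IsRegularity r ∧ (n : ℤ) - 2 ≤ r ∧ r ≤ (n : ℤ) - 1 := by
  classical
  have hb := betti_complementaryEdgeIdeal K G hn F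
  simp only [Set.mem_insert_iff, Set.mem_singleton_iff, Prod.mk.injEq] at hb
  set T : Set ℤ := {s : ℤ | ∃ i j : ℕ, F.betti i j ≠ 0 ∧ s = (j : ℤ) - (i : ℤ)} with hT
  have hup : ∀ s ∈ T, s = (n : ℤ) - 2 ∨ s = (n : ℤ) - 1 := by
    rintro s ⟨i, j, hij, rfl⟩
    have := hb i j hij
    omega
  have hrank : F.rank 0 ≠ 0 := by
    intro h0
    have hE : IsEmpty (Fin (F.rank 0)) := by rw [h0]; infer_instance
    obtain ⟨v, w, hvw⟩ := hG
    obtain ⟨x, hx⟩ := F.range_aug.ge (Ideal.subset_span ⟨v, w, hvw, rfl⟩)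
    rw [Subsingleton.elim x 0, map_zero] at hx
    exact Finset.prod_ne_zero_iff.2 (fun k _ => X_ne_zero k) hx.symm
  have hmem : (n : ℤ) - 2 ∈ T := by
    have h1 : F.betti 0 (F.deg 0 ⟨0, Nat.pos_of_ne_zero hrank⟩) ≠ 0 :=
      (F.betti_ne_zero_iff _ _).2 ⟨_, rfl⟩
    refine ⟨_, _, h1, ?_⟩
    have := hb _ _ h1
    omega
  by_cases h : (n : ℤ) - 1 ∈ T
  · exact ⟨_, ⟨h, fun s hs => by have := hup s hs; omega⟩, by omega, le_rfl⟩
  · refine ⟨_, ⟨hmem, fun s hs => ?_⟩, le_rfl, by omega⟩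
    rcases hup s hs with rfl | rfl
    · exact le_rfl
    · exact absurd hs h

theorem proposition3p1 {K : Type*} [Field K] {n : ℕ} (hn : 4 ≤ n) (G : SimpleGraph (Fin n)) :
    Nonempty (MinimalGradedFreeResolution (complementaryEdgeIdeal K G)) ∧
    (∀ (F : MinimalGradedFreeResolution (complementaryEdgeIdeal K G)) (i j : ℕ),
      F.betti i j ≠ 0 →
        (i, j) ∈ ({(0, n - 2), (1, n - 1), (1, n), (2, n)} : Set (ℕ × ℕ))) ∧
    ((∀ v, ∃ w, G.Adj v w) →
      (1 ≤ CategoryTheory.projectiveDimension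
          (ModuleCat.of (MvPolynomial (Fin n) K) (complementaryEdgeIdeal K G)) ∧
        CategoryTheory.projectiveDimension
          (ModuleCat.of (MvPolynomial (Fin n) K) (complementaryEdgeIdeal K G)) ≤ 2) ∧
      ∀ F : MinimalGradedFreeResolution (complementaryEdgeIdeal K G),
        ∃ r : ℤ, F.IsRegularity r ∧ (n : ℤ) - 2 ≤ r ∧ r ≤ (n : ℤ) - 1) := by
  refine ⟨nonempty_minimalGradedFreeResolution _ (isHomogeneous_complementaryEdgeIdeal G),
    fun F i j h => ?_, fun hG => ⟨⟨one_le_projectiveDimension_complementaryEdgeIdeal G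
      (by omega) hG, projectiveDimension_complementaryEdgeIdeal_le G⟩, fun F =>
      exists_isRegularity_complementaryEdgeIdeal hn G ⟨⟨0, by omega⟩, hG _⟩ F⟩⟩
  classical
  exact betti_complementaryEdgeIdeal K G hn F i j h
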